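/- Let $1\le k\le n$, and let $\mathcal W_{n,k}$ be the set of Fubini words, i.e. surjections $w=w_1\cdots w_n:[n]\to[k]$. For $w\in\mathcal W_{n,k}$ and $a\in[k]$ let $\alpha_a$ be the position of the first letter $a$ in $w$, and put $\mathrm{in}(w)=\{\alpha_1,\dots,\alpha_k\}$. Let $P_w$ be the set of complex $k\times n$ matrices which have a $1$ in position $(w_j,j)$ for every $j\in[n]$, arbitrary entries in the positions $(w_i,j)$ such that $i\in \mathrm{in}(w)$, $i<\alpha_{w_j}$ and either $j\notin\mathrm{in}(w)$ or $w_i<w_j$, and $0$ in all other positions. Let $U$ be the group of lower unitriangular complex $k\times k$ matrices. Let $X_{n,k}$ be the space of $n$-tuples of lines in $\mathbb C^k$ with sum $\mathbb C^k$, with the Zariski topology inherited from $(\mathbb P^{k-1})^n$. Let $C_w\subseteq X_{n,k}$ be the cell of line configurations spanned by the columns of the matrices in $UP_w$, and $\overline C_w$ its closure in $X_{n,k}$. For a $k \times n$ matrix $A$ write $\Delta_{I,J}(A)$ for its minor with rows $I$ and columns $J$, where $|I|=|J|\in[k]$, and $\Delta_J(A)=\Delta_{\{1,\dots,|J|\},J}(A)$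 for its flag minors, where $J\subseteq[n]$ and $1\le|J|\le k$. Let $S_w$ be the set of those $J$ for which $\Delta_J(A)=0$ and $\Delta_J(B)\ne0$ for some $A,B\in UP_w$, and let $T_w$ be the set of those $J$ for which $\Delta_J(A)=0$ for all $A\in UP_w$. Let $I_w\subseteq\mathbb C[x_{11},\dots,x_{kn}]$ be the ideal generated by the minors $\Delta_{I,J}$ that vanish on $UP_w$. The medium roast Fubini–Bruhat order on $\mathcal W_{n,k}$ is defined by $v\le w$ if and only if $C_w\subseteq\overline C_v$. The cell $C_v$ is said to touch $C_w$ if $\overline C_v\cap C_w\neq\emptyset$. Then for all $v,w\in\mathcal W_{n,k}$: 1. $v\le w$ in the medium roast Fubini–Bruhat order if and only if $T_v\subseteq T_w$; the same criterion holds for the two other usual descriptions of this order, that is, $I_v\subseteq I_w$ if and only if $T_v\subseteq T_w$, and (every minor $\Delta_{I,J}$ that vanishes on $UP_v$ vanishes on $UP_w$) if and only if $T_v\subseteq T_w$. 2. $C_v$ touches $C_w$ if and only if $T_v\subseteq S_w\cup T_w$. -/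

import Mathlib

namespace FubiniBruhat

/-- Fubini words of length `n` on the alphabet `[k]`: surjections `[n] → [k]`. Positions and
letters are numbered from `0`. -/
def FubiniWord (n k : ℕ) : Type := {w : Fin n → Fin k // Function.Surjective w}

/-- `w.letter j` is the `j`-th letter of `w`. -/
def FubiniWord.letter {n k : ℕ} (w : FubiniWord n k) (j : Fin n) : Fin k := w.1 j

theorem FubiniWord.positions_nonempty {n k : ℕ} (w : FubiniWord n k) (a : Fin k) :
    (Finset.univ.filter (fun j => w.letter j = a)).Nonempty := by
  obtain ⟨j, hj⟩ := w.2 a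
  exact ⟨j, Finset.mem_filter.mpr ⟨Finset.mem_univ j, hj⟩⟩

/-- `w.alpha a` is the position of the first occurrence of the letter `a` in `w`. -/
def FubiniWord.alpha {n k : ℕ} (w : FubiniWord n k) (a : Fin k) : Fin n :=
  (Finset.univ.filter (fun j => w.letter j = a)).min' (w.positions_nonempty a)

/-- The set `in(w)` of initial positions of `w`. -/
def FubiniWord.initialPositions {n k : ℕ} (w : FubiniWord n k) : Set (Fin n) :=
  Set.range w.alpha

/-- The matrix `M_w`, with a `1` in position `(w_j, j)` for each `j` and `0` elsewhere. -/
def FubiniWord.matrix {n k : ℕ} (w : FubiniWord n k) : Matrix (Fin k) (Fin n) ℂ :=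
  Matrix.of fun r j => if w.letter j = r then 1 else 0

/-- The entry `(r, j)` of the pattern matrix of `w` is a star. -/
def FubiniWord.IsStar {n k : ℕ} (w : FubiniWord n k) (r : Fin k) (j : Fin n) : Prop :=
  ∃ i ∈ w.initialPositions, w.letter i = r ∧ i < w.alpha (w.letter j) ∧
    ((j ∈ w.initialPositions ∧ w.letter i < w.letter j) ∨ j ∉ w.initialPositions)

/-- The set `P_w` of matrices fitting the pattern of `w`: they agree with `M_w` away from the
stars and are arbitrary at the stars. -/
def FubiniWord.patternMatrices {n k : ℕ} (w : FubiniWord n k) :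
    Set (Matrix (Fin k) (Fin n) ℂ) :=
  {Y | ∀ r j, ¬ w.IsStar r j → Y r j = w.matrix r j}

/-- The set `U` of lower unitriangular `k × k` complex matrices. -/
def lowerUnitriangular (k : ℕ) : Set (Matrix (Fin k) (Fin k) ℂ) :=
  {X | (∀ i, X i i = 1) ∧ ∀ i j, i < j → X i j = 0}

/-- The set of matrices `U P_w`. -/
def FubiniWord.cellMatrices {n k : ℕ} (w : FubiniWord n k) : Set (Matrix (Fin k) (Fin n) ℂ) :=
  {A | ∃ X ∈ lowerUnitriangular k, ∃ Y ∈ w.patternMatrices, A = X * Y}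

/-- The space `X_{n,k}` of spanning line configurations: `n`-tuples of lines in `ℂ^k` whose sum
is `ℂ^k`. -/
def SpanningLineConfig (n k : ℕ) : Type :=
  {l : Fin n → Projectivization ℂ (Fin k → ℂ) // ⨆ j, (l j).submodule = ⊤}

/-- The matrix `A` represents the line configuration `l`: for each `j` the line `l_j` is spanned
by the `j`-th column of `A` (so no column of `A` is zero). -/
def SpanningLineConfig.IsRepresentedBy {n k : ℕ} (l : SpanningLineConfig n k)
    (A : Matrix (Fin k) (Fin n) ℂ) : Prop :=
  ∀ j, (l.1 j).submodule = Submodule.span ℂ {fun i => A i j}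

/-- A polynomial in the entries `x_{ij}` of a `k × n` matrix is multihomogeneous if, for some
multidegree `d`, it is homogeneous of degree `d j` in the variables of the `j`-th column, for
every `j`. -/
def IsMultihomogeneous {n k : ℕ} (f : MvPolynomial (Fin k × Fin n) ℂ) : Prop :=
  ∃ d : Fin n → ℕ,
    MvPolynomial.IsWeightedHomogeneous (fun p : Fin k × Fin n => (Pi.single p.2 1 : Fin n → ℕ)) f d

/-- The locus in `X_{n,k}` where `f` does not vanish. For multihomogeneous `f` the choice of the
representing matrix does not matter, since two choices differ by nonzero column scalings. -/
def nonvanishingLocus {n k : ℕ} (f : MvPolynomial (Fin k × Fin n) ℂ) :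
    Set (SpanningLineConfig n k) :=
  {l | ∃ A, l.IsRepresentedBy A ∧ MvPolynomial.eval (fun p => A p.1 p.2) f ≠ 0}

/-- The Zariski topology on `X_{n,k}`, as a subspace of `(ℙ^{k-1})^n`: its basic open sets are the
nonvanishing loci of multihomogeneous polynomials. -/
instance zariskiTopology (n k : ℕ) : TopologicalSpace (SpanningLineConfig n k) :=
  TopologicalSpace.generateFrom
    {s | ∃ f : MvPolynomial (Fin k × Fin n) ℂ, IsMultihomogeneous f ∧ s = nonvanishingLocus f}

/-- The cell `C_w` in `X_{n,k}`: the line configurations represented by matrices in `U P_w`. -/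
def FubiniWord.cell {n k : ℕ} (w : FubiniWord n k) : Set (SpanningLineConfig n k) :=
  {l | ∃ A ∈ w.cellMatrices, l.IsRepresentedBy A}

/-- The variety `closure C_w`, the Zariski closure of the cell in `X_{n,k}`. -/
def FubiniWord.variety {n k : ℕ} (w : FubiniWord n k) : Set (SpanningLineConfig n k) :=
  closure w.cell

/-- Pairs `(I, J)` of a set of rows and a set of columns of the same size `h ≥ 1`. -/
def MinorIndex (n k : ℕ) : Type :=
  {p : Finset (Fin k) × Finset (Fin n) // p.1.card = p.2.card ∧ 1 ≤ p.2.card}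

/-- The minor `Δ_{I,J}(A)`. -/
def minor {n k : ℕ} {R : Type} [CommRing R] (p : MinorIndex n k)
    (A : Matrix (Fin k) (Fin n) R) : R :=
  (A.submatrix (p.1.1.orderEmbOfFin p.2.1) (p.1.2.orderEmbOfFin rfl)).det

/-- The `(I, J)` such that the minor `Δ_{I,J}` vanishes on all of `C_w`. -/
def FubiniWord.vanishingMinors {n k : ℕ} (w : FubiniWord n k) : Set (MinorIndex n k) :=
  {p | ∀ M ∈ w.cellMatrices, minor p M = 0}

/-- The ideal `I_w` of `ℂ[x_{11}, …, x_{kn}]` generated by the minors that vanish on `C_w`. -/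
noncomputable def FubiniWord.minorIdeal {n k : ℕ} (w : FubiniWord n k) :
    Ideal (MvPolynomial (Fin k × Fin n) ℂ) :=
  Ideal.span ((fun p => minor p (Matrix.mvPolynomialX (Fin k) (Fin n) ℂ)) '' w.vanishingMinors)

/-- The medium roast Fubini–Bruhat order `v ≤ w`: the variety of `v` contains the cell of `w`. -/
def MediumRoastLE {n k : ℕ} (v w : FubiniWord n k) : Prop := w.cell ⊆ v.variety

/-- `C_v` touches `C_w`. -/
def Touches {n k : ℕ} (v w : FubiniWord n k) : Prop := (v.variety ∩ w.cell).Nonempty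

/-- The index set of the flag minors: subsets `J` of `[n]` with `1 ≤ |J| ≤ k`. -/
def FlagIndex (n k : ℕ) : Type := {J : Finset (Fin n) // 1 ≤ J.card ∧ J.card ≤ k}

/-- The flag minor `Δ_J(A)`, on the columns in `J` and the first `|J|` rows. -/
def flagMinor {n k : ℕ} {R : Type} [CommRing R] (J : FlagIndex n k)
    (A : Matrix (Fin k) (Fin n) R) : R :=
  (A.submatrix (Fin.castLE J.2.2) (J.1.orderEmbOfFin rfl)).det

/-- `S_w`: the flag minors that vanish somewhere, but not everywhere, on `C_w`. -/
def FubiniWord.sometimes {n k : ℕ} (w : FubiniWord n k) : Set (FlagIndex n k) :=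
  {J | ∃ A ∈ w.cellMatrices, ∃ B ∈ w.cellMatrices, flagMinor J A = 0 ∧ flagMinor J B ≠ 0}

/-- `T_w`: the flag minors that vanish on all of `C_w`. -/
def FubiniWord.truly {n k : ℕ} (w : FubiniWord n k) : Set (FlagIndex n k) :=
  {J | ∀ M ∈ w.cellMatrices, flagMinor J M = 0}

end FubiniBruhat

/-! Everything rests on one fact (`mem_variety_iff`): a configuration represented by `A` lies in the
closure of `C_v` exactly when the flag minors in `T_v` vanish at `A`. One direction holds because
minors are multihomogeneous. For the other, a multihomogeneous `f` vanishing on `UP_v` must vanish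
at every such `A` (`eval_eq_zero_of_flagMinor`).

Row elimination, column scaling and a limit show that `f` vanishes on `U` times all matrices whose
support lies in the staircase `α_r ≤ α_{v_j}`. Any `A` with independent rows is, modulo `U`,
supported in a staircase `c_r ≤ α_{v_j}` with the `c_r` as large as possible. The numbers `#{r ≤ h :
c_r ≤ i}` are then bounded by ranks of northwest blocks of columns, which flag minors detect, so
they are at most `#{r ≤ h : α_r ≤ i}`. As in the tableau criterion for Bruhat order, this inequality
allows passage from `α` to `c` by swaps and increases, each preserving the vanishing of `f`
(`VanishesOnStaircase.of_countLE`).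

The criteria for the order follow. For touching, the configuration of `M_w` is the most degenerate
point of `C_w`: a flag minor nonzero there is nonzero on all of `UP_w`. So if any point of `C_w`
lies in the closure of `C_v`, that one does. -/

namespace FubiniBruhat

/-! ### Determinants and transversals -/

section LinearAlgebra

/-- A matrix that is upper unitriangular for the order pulled back along an injection has
determinant `1`. -/
theorem det_eq_one_of_injective {ι β R : Type*} [Fintype ι] [DecidableEq ι] [LinearOrder β]
    [CommRing R] {g : ι → β} (hg : Function.Injective g) {M : Matrix ι ι R}
    (hM : ∀ a b, M a b ≠ 0 → g a ≤ g b) (hd : ∀ a, M a a = 1) : M.det = 1 := by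
  classical
  let _ : LinearOrder ι := LinearOrder.lift' g hg
  have h : M.BlockTriangular id := by
    intro a b hab
    by_contra h
    exact absurd (hM a b h) (not_le.mpr hab)
  have := Matrix.det_of_isUpperTriangular h
  simp only [hd, Finset.prod_const_one] at this
  convert this

theorem exists_perm_of_det_ne_zero {ι R : Type*} [Fintype ι] [DecidableEq ι] [CommRing R]
    {M : Matrix ι ι R} (hM : M.det ≠ 0) : ∃ σ : Equiv.Perm ι, ∀ i, M (σ i) i ≠ 0 := by
  rw [Matrix.det_apply] at hM
  obtain ⟨σ, -, hσ⟩ := Finset.exists_ne_zero_of_sum_ne_zero hM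
  refine ⟨σ, fun i h => hσ ?_⟩
  have h0 : ∏ j, M (σ j) j = 0 := Finset.prod_eq_zero (Finset.mem_univ i) h
  exact (congrArg _ h0).trans (smul_zero _)

end LinearAlgebra

/-! ### The group of lower unitriangular matrices -/

section LowerUnitriangular

variable {k : ℕ} {X Z : Matrix (Fin k) (Fin k) ℂ}

theorem one_mem_lowerUnitriangular : (1 : Matrix (Fin k) (Fin k) ℂ) ∈ lowerUnitriangular k :=
  ⟨fun i => Matrix.one_apply_eq i, fun _ _ h => Matrix.one_apply_ne h.ne⟩

theorem mul_apply_diag_of_lower (hX : X ∈ lowerUnitriangular k)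
    (hZ : ∀ i j, i < j → Z i j = 0) (i : Fin k) : (X * Z) i i = Z i i := by
  rw [Matrix.mul_apply, Finset.sum_eq_single i]
  · rw [hX.1, one_mul]
  · intro b _ hb
    rcases lt_or_gt_of_ne hb with h | h
    · rw [hZ _ _ h, mul_zero]
    · rw [hX.2 _ _ h, zero_mul]
  · simp

theorem mul_mem_lowerUnitriangular (hX : X ∈ lowerUnitriangular k)
    (hZ : Z ∈ lowerUnitriangular k) : X * Z ∈ lowerUnitriangular k := by
  refine ⟨fun i => by rw [mul_apply_diag_of_lower hX hZ.2, hZ.1], fun i j hij => ?_⟩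
  rw [Matrix.mul_apply]
  refine Finset.sum_eq_zero fun b _ => ?_
  rcases lt_or_ge i b with h | h
  · rw [hX.2 _ _ h, zero_mul]
  · rw [hZ.2 _ _ (h.trans_lt hij), mul_zero]

theorem det_of_mem_lowerUnitriangular (hX : X ∈ lowerUnitriangular k) : X.det = 1 := by
  rw [← Matrix.det_transpose]
  refine det_eq_one_of_injective Function.injective_id (fun a b h => ?_) hX.1
  by_contra hab
  exact h (hX.2 _ _ (not_le.mp hab))

theorem exists_inverse_mem_lowerUnitriangular (hX : X ∈ lowerUnitriangular k) :
    ∃ Z ∈ lowerUnitriangular k, Z * X = 1 := by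
  have hdet : IsUnit X.det := by rw [det_of_mem_lowerUnitriangular hX]; exact isUnit_one
  have hl : X.BlockTriangular OrderDual.toDual := fun i j h => hX.2 _ _ h
  have := X.invertibleOfIsUnitDet hdet
  have hZ : ∀ i j, i < j → X⁻¹ i j = 0 := fun i j h =>
    Matrix.blockTriangular_inv_of_blockTriangular hl h
  refine ⟨X⁻¹, ⟨fun i => ?_, hZ⟩, Matrix.nonsing_inv_mul _ hdet⟩
  rw [← mul_apply_diag_of_lower hX hZ, Matrix.mul_nonsing_inv _ hdet, Matrix.one_apply_eq]

end LowerUnitriangular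

/-! ### Pattern matrices and row elimination -/

namespace FubiniWord

variable {n k : ℕ} (w : FubiniWord n k)

theorem letter_alpha (a : Fin k) : w.letter (w.alpha a) = a :=
  (Finset.mem_filter.mp (Finset.min'_mem _ (w.positions_nonempty a))).2

theorem alpha_injective : Function.Injective w.alpha := fun a b h => by
  rw [← w.letter_alpha a, h, w.letter_alpha]

theorem isStar_iff (r : Fin k) (j : Fin n) : w.IsStar r j ↔
    w.alpha r < w.alpha (w.letter j) ∧ (j ∈ w.initialPositions → r < w.letter j) := by
  constructor
  · rintro ⟨_, ⟨a, rfl⟩, rfl, h, h'⟩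
    rw [w.letter_alpha] at *
    refine ⟨h, fun hj => ?_⟩
    rcases h' with h' | h'
    · exact h'.2
    · exact absurd hj h'
  · rintro ⟨h, h'⟩
    refine ⟨w.alpha r, ⟨r, rfl⟩, w.letter_alpha r, h, ?_⟩
    rw [w.letter_alpha]
    by_cases hj : j ∈ w.initialPositions
    · exact Or.inl ⟨hj, h' hj⟩
    · exact Or.inr hj

variable {w}

theorem alpha_le_of_patternMatrices {Y : Matrix (Fin k) (Fin n) ℂ} (hY : Y ∈ w.patternMatrices)
    {r : Fin k} {j : Fin n} (h : Y r j ≠ 0) : w.alpha r ≤ w.alpha (w.letter j) := by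
  by_cases hs : w.IsStar r j
  · exact ((w.isStar_iff r j).mp hs).1.le
  · rw [hY r j hs] at h
    simp only [matrix, Matrix.of_apply, ne_eq, ite_eq_right_iff, one_ne_zero, imp_false,
      not_not] at h
    rw [h]

theorem patternMatrices_letter {Y : Matrix (Fin k) (Fin n) ℂ} (hY : Y ∈ w.patternMatrices)
    (j : Fin n) : Y (w.letter j) j = 1 := by
  rw [hY _ _ fun h => lt_irrefl _ ((w.isStar_iff _ j).mp h).1]
  simp [matrix]

theorem matrix_mem_patternMatrices : w.matrix ∈ w.patternMatrices := fun _ _ _ => rfl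

theorem matrix_mem_cellMatrices : w.matrix ∈ w.cellMatrices :=
  ⟨1, one_mem_lowerUnitriangular, _, matrix_mem_patternMatrices, (Matrix.one_mul _).symm⟩

/-- Row elimination: a matrix with the staircase support of `w` and ones at the positions
`(w_j, j)` lies in the cell. -/
theorem mul_mem_cellMatrices {X : Matrix (Fin k) (Fin k) ℂ} (hX : X ∈ lowerUnitriangular k)
    {B : Matrix (Fin k) (Fin n) ℂ} (hB : ∀ r j, B r j ≠ 0 → w.alpha r ≤ w.alpha (w.letter j))
    (hd : ∀ j, B (w.letter j) j = 1) : X * B ∈ w.cellMatrices := by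
  -- The staircase positions of row `b` that the pattern forces to be zero are the `w.alpha a` with
  -- `a < b` and `w.alpha b < w.alpha a`. They are cleared with the rows `a` themselves: the square
  -- system `N` is unitriangular in the order of `w.alpha`.
  have key : ∀ b : Fin k, ∃ x : Fin k → ℂ, (∀ a, x a ≠ 0 → a < b ∧ w.alpha b < w.alpha a) ∧
      ∀ a, a < b → w.alpha b < w.alpha a → B b (w.alpha a) + ∑ s, x s * B s (w.alpha a) = 0 := by
    intro b
    let S := {a : Fin k // a < b ∧ w.alpha b < w.alpha a}
    let N : Matrix S S ℂ := Matrix.of fun s t => B s.1 (w.alpha t.1)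
    have hN : N.det = 1 := by
      refine det_eq_one_of_injective (g := fun s : S => w.alpha s.1)
        (fun s t h => Subtype.ext (w.alpha_injective h)) (fun s t h => ?_) (fun s => ?_)
      · simpa [w.letter_alpha] using hB _ _ h
      · simpa [N, w.letter_alpha] using hd (w.alpha s.1)
    have hu : IsUnit N.det := by rw [hN]; exact isUnit_one
    let y : S → ℂ := fun t => -B b (w.alpha t.1)
    let x : S → ℂ := Matrix.vecMul y N⁻¹
    have hx : Matrix.vecMul x N = y := by
      rw [Matrix.vecMul_vecMul, Matrix.nonsing_inv_mul _ hu, Matrix.vecMul_one]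
    have hx0 : ∀ a, ¬ (a < b ∧ w.alpha b < w.alpha a) → Function.extend Subtype.val x 0 a = 0 :=
      fun a ha => Function.extend_apply' _ _ _ fun ⟨s, hs⟩ => ha (hs ▸ s.2)
    refine ⟨Function.extend Subtype.val x 0, fun a ha => not_not.mp (mt (hx0 a) ha),
      fun a ha ha' => ?_⟩
    have h1 := congrFun hx ⟨a, ha, ha'⟩
    rw [← Finset.sum_filter_of_ne (p := fun s => s < b ∧ w.alpha b < w.alpha s)
        fun s _ hs => not_not.mp (mt (hx0 s) (left_ne_zero_of_mul hs)),
      Finset.sum_subtype (p := fun s => s < b ∧ w.alpha b < w.alpha s) _ (by simp)]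
    simp only [Subtype.val_injective.extend_apply]
    simp only [Matrix.vecMul, dotProduct, N, y, Matrix.of_apply] at h1
    rw [h1, add_neg_cancel]
  choose x hx hx0 using key
  let Z : Matrix (Fin k) (Fin k) ℂ := 1 + Matrix.of x
  have hZ : Z ∈ lowerUnitriangular k := by
    refine ⟨fun i => ?_, fun i j hij => ?_⟩
    · have : x i i = 0 := by
        by_contra h; exact lt_irrefl _ (hx i i h).1
      simp [Z, this]
    · have : x i j = 0 := by
        by_contra h; exact lt_asymm hij (hx i j h).1
      simp [Z, this, hij.ne]
  have hZB : ∀ b j, (Z * B) b j = B b j + ∑ s, x b s * B s j := by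
    intro b j
    rw [Matrix.add_mul, Matrix.one_mul]
    simp [Matrix.mul_apply]
  obtain ⟨Z', hZ', hZZ⟩ := exists_inverse_mem_lowerUnitriangular hZ
  refine ⟨X * Z', mul_mem_lowerUnitriangular hX hZ', Z * B, fun r j hs => ?_, ?_⟩
  · rw [hZB]
    rw [isStar_iff, not_and] at hs
    -- Rows added to row `r` start strictly later, so they leave its leading entries, in particular
    -- its prescribed ones, unchanged.
    have hsum : ¬ w.alpha r < w.alpha (w.letter j) → ∑ s, x r s * B s j = 0 := by
      intro h
      refine Finset.sum_eq_zero fun s _ => ?_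
      by_contra h0
      exact h ((hx r s (left_ne_zero_of_mul h0)).2.trans_le (hB s j (right_ne_zero_of_mul h0)))
    by_cases hr : w.letter j = r
    · subst hr
      rw [hsum (lt_irrefl _), hd]; simp [matrix]
    · have hM : w.matrix r j = 0 := by simp [matrix, hr]
      rw [hM]
      by_cases hlt : w.alpha r < w.alpha (w.letter j)
      · have h := hs hlt
        rw [Classical.not_imp] at h
        obtain ⟨⟨a, rfl⟩, h⟩ := h
        rw [w.letter_alpha] at h hlt hr
        exact hx0 r a (lt_of_le_of_ne (not_lt.mp h) hr) hlt
      · rw [hsum hlt, add_zero]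
        by_contra h0
        rcases (hB r j h0).lt_or_eq with h | h
        · exact hlt h
        · exact hr (w.alpha_injective h).symm
  · rw [Matrix.mul_assoc, ← Matrix.mul_assoc Z', hZZ, Matrix.one_mul]

end FubiniWord

/-! ### Vanishing on staircases, by limits along lines -/

section Staircase

open MvPolynomial

variable {n k : ℕ} {f : MvPolynomial (Fin k × Fin n) ℂ}

/-- A polynomial that vanishes at almost all points of a line in the space of matrices vanishes on
the whole line. -/
theorem eval_eq_zero_of_line (f : MvPolynomial (Fin k × Fin n) ℂ) (A B : Matrix (Fin k) (Fin n) ℂ)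
    {s : Set ℂ} (hs : s.Finite) (h : ∀ t ∉ s, eval (fun p => (A + t • B) p.1 p.2) f = 0) :
    eval (fun p => A p.1 p.2) f = 0 := by
  let P : Polynomial ℂ := eval₂ Polynomial.C
    (fun p => Polynomial.C (A p.1 p.2) + Polynomial.X * Polynomial.C (B p.1 p.2)) f
  have hP : ∀ t, P.eval t = eval (fun p => (A + t • B) p.1 p.2) f := by
    intro t
    have h1 := (hom_eval₂ f Polynomial.C (Polynomial.evalRingHom t)
      (fun p => Polynomial.C (A p.1 p.2) + Polynomial.X * Polynomial.C (B p.1 p.2)))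
    simp only [Polynomial.coe_evalRingHom] at h1
    rw [h1, eval, coe_eval₂Hom]
    congr 1
    · ext
      · simp
    · ext p
      simp only [Matrix.add_apply, Matrix.smul_apply, smul_eq_mul, Polynomial.eval_add,
        Polynomial.eval_C, Polynomial.eval_mul, Polynomial.eval_X]
  have hP0 : P = 0 := by
    refine Polynomial.eq_zero_of_infinite_isRoot P (hs.infinite_compl.mono fun t ht => ?_)
    rw [Set.mem_ofPred_eq, Polynomial.IsRoot, hP]
    exact h t ht
  have := hP 0
  rw [hP0] at this
  simpa using this.symm

theorem eval_mul_column {d : Fin n → ℕ} (hf : IsWeightedHomogeneous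
      (fun p : Fin k × Fin n => (Pi.single p.2 1 : Fin n → ℕ)) f d)
    (A : Matrix (Fin k) (Fin n) ℂ) (c : Fin n → ℂ) :
    eval (fun p => c p.2 * A p.1 p.2) f = (∏ j, c j ^ d j) * eval (fun p => A p.1 p.2) f := by
  rw [eval_eq', eval_eq', Finset.mul_sum]
  refine Finset.sum_congr rfl fun e he => ?_
  have hd : ∀ j, d j = ∑ i, e (i, j) := by
    intro j
    rw [← hf (mem_support_iff.mp he), Finsupp.weight_apply, Finsupp.sum_fintype _ _ (by simp),
      Finset.sum_apply, Fintype.sum_prod_type]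
    refine Finset.sum_congr rfl fun i _ => ?_
    simp [Pi.single_apply]
  have : ∏ p : Fin k × Fin n, c p.2 ^ e p = ∏ j, c j ^ d j := by
    rw [Fintype.prod_prod_type_right]
    refine Finset.prod_congr rfl fun j _ => ?_
    rw [hd]
    exact Finset.prod_pow_eq_pow_sum Finset.univ (fun i => e (i, j)) (c j)
  simp only [mul_pow, Finset.prod_mul_distrib, this]
  ring

/-- `f` vanishes at all products `X * B` with `X` lower unitriangular and `B` supported on the
positions `(r, j)` with `q r ≤ m j`. -/
def VanishesOnStaircase (f : MvPolynomial (Fin k × Fin n) ℂ) (m : Fin n → Fin n)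
    (q : Fin k → Fin n) : Prop :=
  ∀ X ∈ lowerUnitriangular k, ∀ B : Matrix (Fin k) (Fin n) ℂ,
    (∀ r j, B r j ≠ 0 → q r ≤ m j) → eval (fun p => (X * B) p.1 p.2) f = 0

variable {m : Fin n → Fin n} {q c : Fin k → Fin n}

theorem VanishesOnStaircase.mono (h : VanishesOnStaircase f m q) (hqc : q ≤ c) :
    VanishesOnStaircase f m c :=
  fun X hX B hB => h X hX B fun r j hj => (hqc r).trans (hB r j hj)

/-- A limit of elementary row operations. Row `b` of `B` may now start earlier than row `a`. Adding
`t` times row `b` to row `a` makes row `a` long; subtracting `t⁻¹` times the new row `a` from row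
`b` then leaves `-t⁻¹ B_a`, which is short. So `B + t D` lies in `U` times the old staircase for `t
≠ 0`, and `t` tends to `0`. -/
theorem VanishesOnStaircase.swap (h : VanishesOnStaircase f m q) {a b : Fin k} (hab : a < b)
    (hq : q a < q b) : VanishesOnStaircase f m (q ∘ Equiv.swap a b) := by
  intro X hX B hB
  have hBa : ∀ j, B a j ≠ 0 → q b ≤ m j := fun j hj => by simpa using hB a j hj
  have hBb : ∀ j, B b j ≠ 0 → q a ≤ m j := fun j hj => by simpa using hB b j hj
  have hBr : ∀ r j, r ≠ a → r ≠ b → B r j ≠ 0 → q r ≤ m j := fun r j ha hb hj => by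
    simpa [Equiv.swap_apply_of_ne_of_ne ha hb] using hB r j hj
  let D : Matrix (Fin k) (Fin n) ℂ := Matrix.of fun r j => if r = a then B b j else 0
  refine eval_eq_zero_of_line f (X * B) (X * D) (Set.finite_singleton 0) fun t ht => ?_
  have ht0 : t ≠ 0 := ht
  let Z : Matrix (Fin k) (Fin k) ℂ :=
    1 + Matrix.of fun r s => if r = b ∧ s = a then t⁻¹ else 0
  have hZ : Z ∈ lowerUnitriangular k := by
    refine ⟨fun i => ?_, fun i j hij => ?_⟩
    · have : ¬ (i = b ∧ i = a) := fun h => hab.ne (h.2.symm.trans h.1)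
      simp [Z, this]
    · have : ¬ (i = b ∧ j = a) := fun h => lt_asymm hab (h.1 ▸ h.2 ▸ hij)
      simp [Z, this, hij.ne]
  let C : Matrix (Fin k) (Fin n) ℂ := Matrix.of fun r j =>
    if r = a then B a j + t * B b j else if r = b then -(t⁻¹ * B a j) else B r j
  have hC : ∀ r j, C r j ≠ 0 → q r ≤ m j := by
    intro r j hj
    by_cases hra : r = a
    · subst hra
      by_cases h0 : B b j = 0
      · refine hq.le.trans (hBa j fun h1 => hj ?_)
        simp [C, h0, h1]
      · exact hBb j h0
    · by_cases hrb : r = b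
      · subst hrb
        refine hBa j fun h1 => hj ?_
        simp [C, h1, hra]
      · refine hBr r j hra hrb ?_
        simpa [C, hra, hrb] using hj
  have hZC : Z * C = B + t • D := by
    ext r j
    rw [Matrix.add_mul, Matrix.one_mul, Matrix.add_apply, Matrix.mul_apply]
    by_cases hra : r = a
    · subst hra
      simp [C, D, hab.ne]
    · by_cases hrb : r = b
      · subst hrb
        rw [Finset.sum_eq_single a (fun s _ hs => by simp [hs]) (by simp)]
        simp [C, D, hra]
        field_simp
        ring
      · simp [C, D, hra, hrb]
  have := h (X * Z) (mul_mem_lowerUnitriangular hX hZ) C hC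
  rwa [Matrix.mul_assoc, hZC, Matrix.mul_add, Matrix.mul_smul] at this

theorem FubiniWord.vanishesOnStaircase_alpha {v : FubiniWord n k} (hf : IsMultihomogeneous f)
    (h : ∀ M ∈ v.cellMatrices, eval (fun p => M p.1 p.2) f = 0) :
    VanishesOnStaircase f (fun j => v.alpha (v.letter j)) v.alpha := by
  obtain ⟨d, hd⟩ := hf
  -- If the entries at `(v_j, j)` are nonzero, column scaling turns them into ones, and
  -- multihomogeneity makes this harmless.
  have h1 : ∀ X ∈ lowerUnitriangular k, ∀ B : Matrix (Fin k) (Fin n) ℂ,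
      (∀ r j, B r j ≠ 0 → v.alpha r ≤ v.alpha (v.letter j)) → (∀ j, B (v.letter j) j ≠ 0) →
      eval (fun p => (X * B) p.1 p.2) f = 0 := by
    intro X hX B hB hne
    let C : Matrix (Fin k) (Fin n) ℂ := Matrix.of fun r j => (B (v.letter j) j)⁻¹ * B r j
    have hC : X * C ∈ v.cellMatrices := by
      refine v.mul_mem_cellMatrices hX (fun r j hj => hB r j (right_ne_zero_of_mul hj))
        fun j => inv_mul_cancel₀ (hne j)
    have h2 : ∀ p : Fin k × Fin n,
        (X * B) p.1 p.2 = B (v.letter p.2) p.2 * (X * C) p.1 p.2 := by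
      rintro ⟨r, j⟩
      simp only [Matrix.mul_apply, C, Matrix.of_apply, Finset.mul_sum]
      refine Finset.sum_congr rfl fun s _ => ?_
      field_simp [hne j]
    rw [funext h2, eval_mul_column hd (X * C) fun j => B (v.letter j) j, h _ hC, mul_zero]
  intro X hX B hB
  -- The remaining matrices are limits of `B + t M_v`; only the finitely many `t = -B_{v_j, j}` are
  -- excluded.
  refine eval_eq_zero_of_line f (X * B) (X * v.matrix)
    (Set.finite_range fun j => -B (v.letter j) j) fun t ht => ?_
  rw [← Matrix.mul_smul, ← Matrix.mul_add]
  refine h1 X hX _ (fun r j hj => ?_) fun j hj => ht ⟨j, ?_⟩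
  · by_cases hr : v.letter j = r
    · rw [hr]
    · refine hB r j ?_
      simpa [FubiniWord.matrix, hr] using hj
  · simp only [FubiniWord.matrix, Matrix.add_apply, Matrix.smul_apply, Matrix.of_apply, if_true,
      smul_eq_mul, mul_one] at hj
    linear_combination -hj

end Staircase

/-! ### The chain of swaps and increases between two staircases -/

section Chain

variable {n k : ℕ}

/-- The number of letters `a ≤ h` with `q a ≤ i`. -/
def countLE (q : Fin k → Fin n) (h : Fin k) (i : Fin n) : ℕ :=
  (Finset.univ.filter fun a => a ≤ h ∧ q a ≤ i).card

theorem lt_of_countLE {q c : Fin k → Fin n} {a : Fin k} (hqc : countLE c a (c a) ≤ countLE q a (c a))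
    (heq : ∀ b < a, q b = c b) (hne : q a ≠ c a) : q a < c a := by
  by_contra hlt
  have hlt : c a < q a := lt_of_le_of_ne (not_lt.mp hlt) hne.symm
  refine absurd hqc (not_le.mpr (Finset.card_lt_card ⟨fun b hb => ?_, fun hsub => ?_⟩))
  · simp only [Finset.mem_filter, Finset.mem_univ, true_and] at hb ⊢
    rcases hb.1.lt_or_eq with h | rfl
    · exact ⟨hb.1, heq b h ▸ hb.2⟩
    · exact absurd hb.2 (not_le.mpr hlt)
  · have := hsub (show a ∈ _ by simp)
    simp only [Finset.mem_filter, Finset.mem_univ, true_and] at this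
    exact absurd this.2 (not_le.mpr hlt)

/-- Among the letters up to `h`, those with value in `(i, c a]` are fewer for `q` than for `c`: for
`q` they all precede `a`, where both functions agree, while `c` also has `a` itself. Subtracting
from the counts at `c a` makes the inequality at `i` strict. This is the slack that a swap or an
increase uses up. -/
theorem countLE_lt {q c : Fin k → Fin n} {a h : Fin k} {i : Fin n}
    (hqc : countLE c h (c a) ≤ countLE q h (c a)) (heq : ∀ b < a, q b = c b) (hah : a ≤ h)
    (hb : ∀ b, a < b → b ≤ h → q b ≤ q a ∨ c a < q b) (hi : q a ≤ i) (hi' : i < c a) :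
    countLE c h i < countLE q h i := by
  have split : ∀ p : Fin k → Fin n, countLE p h (c a) = countLE p h i +
      (Finset.univ.filter fun b => b ≤ h ∧ i < p b ∧ p b ≤ c a).card := by
    intro p
    rw [countLE, countLE, ← Finset.card_union_of_disjoint]
    · congr 1
      ext b
      simp only [Finset.mem_filter, Finset.mem_univ, true_and, Finset.mem_union]
      constructor
      · rintro ⟨h1, h2⟩
        rcases le_or_gt (p b) i with h3 | h3
        · exact Or.inl ⟨h1, h3⟩
        · exact Or.inr ⟨h1, h3, h2⟩
      · rintro (⟨h1, h2⟩ | ⟨h1, h2, h3⟩)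
        · exact ⟨h1, h2.trans hi'.le⟩
        · exact ⟨h1, h3⟩
    · rw [Finset.disjoint_filter]
      exact fun b _ h1 h2 => not_lt.mpr h1.2 h2.2.1
  rw [split, split] at hqc
  have : (Finset.univ.filter fun b => b ≤ h ∧ i < q b ∧ q b ≤ c a).card <
      (Finset.univ.filter fun b => b ≤ h ∧ i < c b ∧ c b ≤ c a).card := by
    refine Finset.card_lt_card ⟨fun b hb' => ?_, fun hsub => ?_⟩
    · simp only [Finset.mem_filter, Finset.mem_univ, true_and] at hb' ⊢
      obtain ⟨h1, h2, h3⟩ := hb'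
      rcases lt_trichotomy b a with hlt | rfl | hgt
      · rw [← heq b hlt]; exact ⟨h1, h2, h3⟩
      · exact absurd h2 (not_lt.mpr hi)
      · rcases hb b hgt h1 with h4 | h4
        · exact absurd h2 (not_lt.mpr (h4.trans hi))
        · exact absurd h3 (not_le.mpr h4)
    · have := hsub (show a ∈ _ by simp [hah, hi'])
      simp only [Finset.mem_filter, Finset.mem_univ, true_and] at this
      exact not_lt.mpr hi this.2.1
  omega

theorem countLE_le_update {q c : Fin k → Fin n} {a : Fin k}
    (hqc : ∀ h i, countLE c h i ≤ countLE q h i)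
    (hlt : ∀ h i, a ≤ h → q a ≤ i → i < c a → countLE c h i < countLE q h i) (h : Fin k)
    (i : Fin n) : countLE c h i ≤ countLE (Function.update q a (c a)) h i := by
  by_cases hcase : a ≤ h ∧ q a ≤ i ∧ i < c a
  · have h1 := hlt h i hcase.1 hcase.2.1 hcase.2.2
    have h2 : countLE q h i - 1 ≤ countLE (Function.update q a (c a)) h i := by
      rw [countLE, ← Finset.card_erase_of_mem (a := a) (by simp [hcase.1, hcase.2.1])]
      refine Finset.card_le_card fun b hb => ?_
      simp only [Finset.mem_erase, Finset.mem_filter, Finset.mem_univ, true_and] at hb ⊢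
      simpa [hb.1] using hb.2
    omega
  · refine (hqc h i).trans (Finset.card_le_card fun b hb => ?_)
    simp only [Finset.mem_filter, Finset.mem_univ, true_and] at hb ⊢
    refine ⟨hb.1, ?_⟩
    by_cases hba : b = a
    · subst hba
      rw [Function.update_self]
      exact not_lt.mp fun h3 => hcase ⟨hb.1, hb.2, h3⟩
    · simpa [hba] using hb.2

theorem countLE_le_swap {q c : Fin k → Fin n} {a b : Fin k} (hab : a < b) (hq : q a < q b)
    (hqc : ∀ h i, countLE c h i ≤ countLE q h i)
    (hlt : ∀ h i, a ≤ h → h < b → q a ≤ i → i < q b → countLE c h i < countLE q h i) (h : Fin k)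
    (i : Fin n) : countLE c h i ≤ countLE (q ∘ Equiv.swap a b) h i := by
  rcases le_or_gt b h with hbh | hbh
  · refine (hqc h i).trans (Finset.card_le_card_of_injOn (Equiv.swap a b) (fun x hx => ?_)
      (Equiv.swap a b).injective.injOn)
    simp only [Finset.coe_filter, Finset.mem_univ, true_and, Set.mem_ofPred_eq,
      Function.comp_apply, Equiv.swap_apply_self] at hx ⊢
    refine ⟨?_, hx.2⟩
    rw [Equiv.swap_apply_def]
    split_ifs
    · exact hbh
    · exact hab.le.trans hbh
    · exact hx.1
  · by_cases hcase : a ≤ h ∧ q a ≤ i ∧ i < q b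
    · have h1 := hlt h i hcase.1 hbh hcase.2.1 hcase.2.2
      have h2 : countLE q h i - 1 ≤ countLE (q ∘ Equiv.swap a b) h i := by
        rw [countLE, ← Finset.card_erase_of_mem (a := a) (by simp [hcase.1, hcase.2.1])]
        refine Finset.card_le_card fun x hx => ?_
        simp only [Finset.mem_erase, Finset.mem_filter, Finset.mem_univ, true_and,
          Function.comp_apply] at hx ⊢
        rw [Equiv.swap_apply_of_ne_of_ne hx.1 (hx.2.1.trans_lt hbh).ne]
        exact hx.2
      omega
    · refine (hqc h i).trans (Finset.card_le_card fun x hx => ?_)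
      simp only [Finset.mem_filter, Finset.mem_univ, true_and, Function.comp_apply] at hx ⊢
      refine ⟨hx.1, ?_⟩
      by_cases hxa : x = a
      · subst hxa
        rw [Equiv.swap_apply_left]
        exact not_lt.mp fun h3 => hcase ⟨hx.1, hx.2, h3⟩
      · rw [Equiv.swap_apply_of_ne_of_ne hxa (hx.1.trans_lt hbh).ne]
        exact hx.2

theorem VanishesOnStaircase.of_countLE {f : MvPolynomial (Fin k × Fin n) ℂ} {m : Fin n → Fin n}
    {c : Fin k → Fin n} (q : Lex (Fin k → Fin n)) (hf : VanishesOnStaircase f m (ofLex q))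
    (hqc : ∀ h i, countLE c h i ≤ countLE (ofLex q) h i) : VanishesOnStaircase f m c := by
  -- Each move makes `q` lexicographically larger, and there are finitely many functions.
  induction q using WellFoundedGT.induction with
  | ind q ih =>
  obtain ⟨q, rfl⟩ := toLex.surjective q
  simp only [ofLex_toLex] at hf hqc ih
  by_cases hne : ∃ a, q a ≠ c a
  · obtain ⟨a, ha, hmin⟩ : ∃ a, q a ≠ c a ∧ ∀ b < a, q b = c b := by
      obtain ⟨a, ha, hmin⟩ := WellFounded.has_min (wellFounded_lt (α := Fin k))
        {a | q a ≠ c a} hne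
      exact ⟨a, ha, fun b hb => not_not.mp fun h => hmin b h hb⟩
    have hlt := lt_of_countLE (hqc a (c a)) hmin ha
    -- At the first disagreement `a`, swap with the first later `b` whose value lies in `(q a, c
    -- a]`, so that no value in between obstructs `countLE_lt`. If there is none, `q a` can be
    -- raised to `c a` at once.
    by_cases hb : ∃ b, a < b ∧ q a < q b ∧ q b ≤ c a
    · obtain ⟨b, ⟨hab, hb1, hb2⟩, hbmin⟩ := WellFounded.has_min (wellFounded_lt (α := Fin k))
        {b | a < b ∧ q a < q b ∧ q b ≤ c a} hb
      refine ih (toLex (q ∘ Equiv.swap a b)) ⟨a, fun x hx => ?_, ?_⟩ (hf.swap hab hb1)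
        (countLE_le_swap hab hb1 hqc fun h i h1 h2 h3 h4 => ?_)
      · simp [Equiv.swap_apply_of_ne_of_ne hx.ne (hx.trans hab).ne]
      · simpa using hb1
      · refine countLE_lt (hqc h (c a)) hmin h1 (fun x hx hx' => ?_) h3 (h4.trans_le hb2)
        by_contra hcon
        rw [not_or, not_le, not_lt] at hcon
        exact hbmin x ⟨hx, hcon⟩ (hx'.trans_lt h2)
    · refine ih (toLex (Function.update q a (c a))) ⟨a, fun x hx => ?_, ?_⟩
        (hf.mono fun x => ?_)
        (countLE_le_update hqc fun h i h1 h3 h4 => ?_)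
      · simp [hx.ne]
      · simpa using hlt
      · by_cases hx : x = a
        · subst hx; simpa using hlt.le
        · simp [hx]
      · refine countLE_lt (hqc h (c a)) hmin h1 (fun x hx hx' => ?_) h3 h4
        by_contra hcon
        rw [not_or, not_le, not_lt] at hcon
        exact hb ⟨x, hx, hcon⟩
  · rw [show c = q from funext fun a => (not_not.mp fun h => hne ⟨a, h⟩).symm]
    exact hf

end Chain

/-! ### The staircase of a matrix and its control by flag minors -/

variable {n k : ℕ}

/-- A matrix with independent rows has, up to left multiplication by a lower unitriangular matrix,
rows that start as late as possible. -/
theorem exists_lowerUnitriangular_mul_staircase {A : Matrix (Fin k) (Fin n) ℂ}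
    (hA : ∀ x, Matrix.vecMul x A = 0 → x = 0) (m : Fin n → Fin n) :
    ∃ X ∈ lowerUnitriangular k, ∃ c : Fin k → Fin n,
      (∀ r j, (X * A) r j ≠ 0 → c r ≤ m j) ∧
      ∀ (i : Fin n) (y : Fin k → ℂ), (∀ a, y a ≠ 0 → c a ≤ i) →
        (∀ j, m j ≤ i → Matrix.vecMul y (X * A) j = 0) → y = 0 := by
  -- Among all row vectors with last nonzero coordinate `1` in place `a`, choose one whose product
  -- with `A` starts latest; `i` is that start.
  have key : ∀ a : Fin k, ∃ x : Fin k → ℂ, x a = 1 ∧ (∀ b, a < b → x b = 0) ∧ ∃ i : Fin n,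
      (∀ j, Matrix.vecMul x A j ≠ 0 → i ≤ m j) ∧ ∀ x' : Fin k → ℂ, x' a = 1 →
        (∀ b, a < b → x' b = 0) → ∃ j, Matrix.vecMul x' A j ≠ 0 ∧ m j ≤ i := by
    intro a
    let P : Fin n → Prop := fun i => ∃ x : Fin k → ℂ, x a = 1 ∧ (∀ b, a < b → x b = 0) ∧
      ∀ j, Matrix.vecMul x A j ≠ 0 → i ≤ m j
    have hstart : ∀ x : Fin k → ℂ, x a = 1 → ∃ j, Matrix.vecMul x A j ≠ 0 ∧
        ∀ j', Matrix.vecMul x A j' ≠ 0 → m j ≤ m j' := by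
      intro x hx
      have hne : (Finset.univ.filter fun j => Matrix.vecMul x A j ≠ 0).Nonempty := by
        by_contra h
        have h0 : x = 0 := hA x (funext fun j => by
          by_contra hj
          exact h ⟨j, by simpa using hj⟩)
        rw [h0] at hx
        exact zero_ne_one hx
      obtain ⟨j, hj, hmin⟩ := Finset.exists_min_image _ m hne
      exact ⟨j, by simpa using hj, fun j' hj' => hmin j' (by simpa using hj')⟩
    have hPne : {i | P i}.Nonempty := by
      obtain ⟨j, -, hj⟩ := hstart (Pi.single a 1) (by simp)
      exact ⟨m j, Pi.single a 1, by simp, fun b hb => by simp [hb.ne'], hj⟩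
    obtain ⟨i, ⟨x, hx1, hx2, hx3⟩, hmax⟩ := WellFounded.has_min (wellFounded_gt (α := Fin n)) _ hPne
    refine ⟨x, hx1, hx2, i, hx3, fun x' hx' hx'' => ?_⟩
    obtain ⟨j, hj, hj'⟩ := hstart x' hx'
    exact ⟨j, hj, not_lt.mp (hmax (m j) ⟨x', hx', hx'', hj'⟩)⟩
  choose x hx1 hx2 c hc hmax using key
  have hrow : ∀ r j, (Matrix.of x * A) r j = Matrix.vecMul (x r) A j := fun r j => rfl
  refine ⟨Matrix.of x, ⟨hx1, fun i j hij => hx2 i j hij⟩, c, fun r j h => hc r j h, ?_⟩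
  intro i y hy hy0
  by_contra hne
  obtain ⟨a, ha, hamax⟩ := WellFounded.has_min (wellFounded_gt (α := Fin k)) {a | y a ≠ 0}
    (Function.ne_iff.mp hne)
  have hlast : ∀ b, a < b → y b = 0 := fun b hb => not_not.mp fun h => hamax b h hb
  -- With `a` the last index in the support of `y`, this normalised combination competes for row
  -- `a`, so it cannot start after `c a`, contradicting the vanishing up to `i`.
  let z : Fin k → ℂ := (y a)⁻¹ • Matrix.vecMul y (Matrix.of x)
  have hz : ∀ b, a ≤ b → Matrix.vecMul y (Matrix.of x) b = y a * x a b := by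
    intro b hb
    simp only [Matrix.vecMul, dotProduct, Matrix.of_apply]
    refine Finset.sum_eq_single a (fun s _ hs => ?_) (by simp)
    rcases lt_or_gt_of_ne hs with h | h
    · rw [hx2 s b (h.trans_le hb), mul_zero]
    · rw [hlast s h, zero_mul]
  obtain ⟨j, hj, hj'⟩ := hmax a z (by simp [z, hz a le_rfl, hx1, inv_mul_cancel₀ ha])
    (fun b hb => by simp [z, hz b hb.le, hx2 a b hb])
  refine hj ?_
  have := hy0 j (hj'.trans (hy a ha))
  rw [← Matrix.vecMul_vecMul] at this
  simp only [z, Matrix.smul_vecMul, Pi.smul_apply, this, smul_zero]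

/-- Flag minors are unchanged by left multiplication by a lower unitriangular matrix. -/
theorem flagMinor_mul {X : Matrix (Fin k) (Fin k) ℂ} (hX : X ∈ lowerUnitriangular k)
    (J : FlagIndex n k) (Y : Matrix (Fin k) (Fin n) ℂ) :
    flagMinor J (X * Y) = flagMinor J Y := by
  have h : (X * Y).submatrix (Fin.castLE J.2.2) (J.1.orderEmbOfFin rfl) =
      X.submatrix (Fin.castLE J.2.2) (Fin.castLE J.2.2) *
        Y.submatrix (Fin.castLE J.2.2) (J.1.orderEmbOfFin rfl) := by
    ext r s
    simp only [Matrix.submatrix_apply, Matrix.mul_apply]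
    rw [← Finset.sum_subset (Finset.subset_univ (Finset.univ.map (Fin.castLEEmb J.2.2))),
      Finset.sum_map]
    · rfl
    · intro t _ ht
      have : Fin.castLE J.2.2 r < t := by
        by_contra hlt
        refine ht (Finset.mem_map.mpr ⟨⟨t, ?_⟩, Finset.mem_univ _, rfl⟩)
        exact lt_of_le_of_lt (Fin.le_def.mp (not_lt.mp hlt)) r.2
      rw [hX.2 _ _ this, zero_mul]
  have hdet : (X.submatrix (Fin.castLE J.2.2) (Fin.castLE J.2.2)).det = 1 := by
    refine det_of_mem_lowerUnitriangular ⟨fun i => hX.1 _, fun i j hij => hX.2 _ _ ?_⟩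
    exact hij
  rw [flagMinor, h, Matrix.det_mul, hdet, one_mul, flagMinor]

/-- A nonzero term in the expansion of the minor of a pattern matrix matches the columns of `J`
injectively with the first rows, sending `j` to some `r` with `v.alpha r ≤ v.alpha (v.letter j)`. -/
theorem FubiniWord.card_filter_le_of_notMem_truly {v : FubiniWord n k} {J : FlagIndex n k}
    (hJ : J ∉ v.truly) (i : Fin n) :
    (J.1.filter fun j => v.alpha (v.letter j) ≤ i).card ≤
      (Finset.univ.filter fun r : Fin k => r.val < J.1.card ∧ v.alpha r ≤ i).card := by
  simp only [truly, Set.mem_ofPred_eq, not_forall] at hJ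
  obtain ⟨_, ⟨X, hX, Y, hY, rfl⟩, hne⟩ := hJ
  rw [flagMinor_mul hX] at hne
  obtain ⟨σ, hσ⟩ := exists_perm_of_det_ne_zero hne
  have himg : (J.1.filter fun j => v.alpha (v.letter j) ≤ i) = (Finset.univ.filter
      fun s => v.alpha (v.letter (J.1.orderEmbOfFin rfl s)) ≤ i).image (J.1.orderEmbOfFin rfl) := by
    ext j
    simp only [Finset.mem_filter, Finset.mem_image, Finset.mem_univ, true_and]
    constructor
    · rintro ⟨hj, hj'⟩
      rw [← Finset.mem_coe, ← Finset.range_orderEmbOfFin J.1 rfl] at hj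
      obtain ⟨s, rfl⟩ := hj
      exact ⟨s, hj', rfl⟩
    · rintro ⟨s, hs, rfl⟩
      exact ⟨Finset.orderEmbOfFin_mem _ _ _, hs⟩
  rw [himg]
  refine Finset.card_image_le.trans (Finset.card_le_card_of_injOn
    (fun s => Fin.castLE J.2.2 (σ s)) (fun s hs => ?_)
    ((Fin.castLE_injective J.2.2).comp σ.injective).injOn)
  simp only [Finset.coe_filter, Finset.mem_univ, true_and, Set.mem_ofPred_eq] at hs ⊢
  exact ⟨(σ s).2, (alpha_le_of_patternMatrices hY (hσ s)).trans hs⟩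

/-- A basis of the span of the columns in `E`, truncated to the rows up to `h`, extends to a flag
minor that does not vanish. -/
theorem exists_flagMinor_ne_zero {A : Matrix (Fin k) (Fin n) ℂ}
    (hA : ∀ x, Matrix.vecMul x A = 0 → x = 0) (h : Fin k) (E : Set (Fin n)) :
    ∃ J : FlagIndex n k, J.1.card = h + 1 ∧ flagMinor J A ≠ 0 ∧ ∃ J₀ : Finset (Fin n),
      J₀ ⊆ J.1 ∧ (J₀ : Set (Fin n)) ⊆ E ∧ ∀ y : Fin k → ℂ, (∀ a, h < a → y a = 0) →
        (∀ j ∈ J₀, Matrix.vecMul y A j = 0) → ∀ j ∈ E, Matrix.vecMul y A j = 0 := by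
  classical
  have hk : (h : ℕ) + 1 ≤ k := h.2
  let u : Fin n → Fin (h + 1) → ℂ := fun j r => A (Fin.castLE hk r) j
  have hy : ∀ y : Fin k → ℂ, (∀ a, h < a → y a = 0) → ∀ j,
      Matrix.vecMul y A j = dotProduct (fun r => y (Fin.castLE hk r)) (u j) := by
    intro y hy j
    simp only [Matrix.vecMul, dotProduct]
    rw [← Finset.sum_subset (Finset.subset_univ (Finset.univ.map (Fin.castLEEmb hk))),
      Finset.sum_map]
    · rfl
    · intro t _ ht
      have : h < t := by
        by_contra hlt
        refine ht (Finset.mem_map.mpr ⟨⟨t, ?_⟩, Finset.mem_univ _, rfl⟩)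
        exact Nat.lt_succ_of_le (not_lt.mp hlt)
      rw [hy _ this, zero_mul]
  have hspan : ∀ (z : Fin (h + 1) → ℂ) (s : Set (Fin n)), (∀ j ∈ s, dotProduct z (u j) = 0) →
      ∀ x ∈ Submodule.span ℂ (u '' s), dotProduct z x = 0 := by
    intro z s hz x hx
    induction hx using Submodule.span_induction with
    | mem x hx => obtain ⟨j, hj, rfl⟩ := hx; exact hz j hj
    | zero => simp
    | add x y _ _ hx hy => rw [dotProduct_add, hx, hy, add_zero]
    | smul a x _ hx => rw [dotProduct_smul, hx, smul_zero]
  obtain ⟨S₀, hS₀, -, hE, hlin⟩ := exists_linearIndepOn_extension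
    (linearIndepOn_empty ℂ u) (Set.empty_subset E)
  obtain ⟨S, -, hSS, hall, hlinS⟩ := exists_linearIndepOn_extension hlin (Set.subset_univ S₀)
  -- A functional killing all truncated columns would, extended by zero, be a linear relation
  -- between the rows of `A`.
  have htop : Submodule.span ℂ (u '' S) = ⊤ := by
    by_contra hne
    obtain ⟨φ, hφ0, hφ⟩ := Submodule.exists_le_ker_of_lt_top _ (lt_top_iff_ne_top.mpr hne)
    let z : Fin (h + 1) → ℂ := fun r => φ (Pi.single r 1)
    have hz : ∀ x, dotProduct z x = φ x := by
      intro x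
      rw [LinearMap.pi_apply_eq_sum_univ φ x]
      simp only [dotProduct, z, smul_eq_mul, mul_comm]
      refine Finset.sum_congr rfl fun r _ => ?_
      congr 2
      ext s
      simp [Pi.single_apply, eq_comm]
    let y : Fin k → ℂ := fun a => if ha : a.val < h + 1 then z ⟨a, ha⟩ else 0
    have hy0 : y = 0 := by
      refine hA y (funext fun j => ?_)
      rw [hy y (fun a ha => dif_neg (by simpa using ha))]
      have h1 : (fun r => y (Fin.castLE hk r)) = z := funext fun r => dif_pos r.2
      rw [h1, hz]
      exact hφ (hall ⟨j, Set.mem_univ j, rfl⟩)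
    refine hφ0 (LinearMap.ext fun x => ?_)
    rw [← hz]
    have h1 : z = 0 := by
      funext r
      have h2 : y (Fin.castLE hk r) = z r := dif_pos r.2
      exact h2.symm.trans (congrFun hy0 _)
    simp [h1]
  have hcard : S.toFinset.card = h + 1 := by
    have h1 := finrank_span_eq_card (R := ℂ) (b := fun j : S => u j) hlinS
    rw [← Set.image_eq_range, htop, finrank_top, Module.finrank_fin_fun] at h1
    rw [Set.toFinset_card, ← h1]
  refine ⟨⟨S.toFinset, by omega, by omega⟩, hcard, ?_, S₀.toFinset, by simpa using hSS,
    by simpa using hS₀, fun y hy1 hy2 j hj => ?_⟩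
  · have hli : LinearIndependent ℂ (fun s => u (S.toFinset.orderEmbOfFin hcard s)) := by
      have := LinearIndependent.comp hlinS (fun s : Fin (h + 1) =>
        (⟨S.toFinset.orderEmbOfFin hcard s, 
          Set.mem_toFinset.mp (Finset.orderEmbOfFin_mem S.toFinset hcard s)⟩ : S))
        (fun s t hst => by simpa using hst)
      exact this
    -- The size of `S` is `h + 1` only propositionally, so it is made a variable that can be
    -- eliminated.
    have hdet : ∀ (H : ℕ) (hH : S.toFinset.card = H) (hHk : H ≤ k), LinearIndependent ℂ
        (fun s (r : Fin H) => A (Fin.castLE hHk r) (S.toFinset.orderEmbOfFin hH s)) →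
        ∀ p, flagMinor ⟨S.toFinset, p⟩ A ≠ 0 := by
      rintro H rfl hHk hli p
      have h1 : IsUnit (A.submatrix (Fin.castLE p.2) (S.toFinset.orderEmbOfFin rfl)) :=
        Matrix.linearIndependent_cols_iff_isUnit.mp hli
      exact ((Matrix.isUnit_iff_isUnit_det _).mp h1).ne_zero
    exact hdet _ hcard hk hli _
  · rw [hy y hy1]
    refine hspan _ S₀ (fun j hj => ?_) _ (hE ⟨j, hj, rfl⟩)
    rw [← hy y hy1]
    exact hy2 j (by simpa using hj)

/-- If the flag minors that vanish on the cell of `v` vanish at `A`, then the staircase of `A` is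
bounded by that of `v`. -/
theorem FubiniWord.countLE_le_of_flagMinor {v : FubiniWord n k} {A : Matrix (Fin k) (Fin n) ℂ}
    (hA : ∀ x, Matrix.vecMul x A = 0 → x = 0) (hT : ∀ J ∈ v.truly, flagMinor J A = 0)
    {X : Matrix (Fin k) (Fin k) ℂ} (hX : X ∈ lowerUnitriangular k) {c : Fin k → Fin n}
    (hc : ∀ (i : Fin n) (y : Fin k → ℂ), (∀ a, y a ≠ 0 → c a ≤ i) →
      (∀ j, v.alpha (v.letter j) ≤ i → Matrix.vecMul y (X * A) j = 0) → y = 0)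
    (h : Fin k) (i : Fin n) : countLE c h i ≤ countLE v.alpha h i := by
  classical
  obtain ⟨J, hJ, hJA, J₀, hJ₀, hE, hker⟩ :=
    exists_flagMinor_ne_zero hA h {j | v.alpha (v.letter j) ≤ i}
  have h1 := v.card_filter_le_of_notMem_truly (fun hJT => hJA (hT J hJT)) i
  have h2 : J₀.card ≤ (J.1.filter fun j => v.alpha (v.letter j) ≤ i).card :=
    Finset.card_le_card fun j hj => Finset.mem_filter.mpr ⟨hJ₀ hj, hE hj⟩
  have h3 : countLE v.alpha h i =
      (Finset.univ.filter fun r : Fin k => r.val < J.1.card ∧ v.alpha r ≤ i).card := by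
    rw [countLE]
    congr 1
    ext r
    simp only [Finset.mem_filter, Finset.mem_univ, true_and, hJ, Fin.le_def, Nat.lt_succ_iff]
  rw [h3]
  refine le_trans ?_ (h2.trans h1)
  by_contra hlt
  rw [not_le, countLE] at hlt
  -- With more rows in `C` than columns in `J₀`, some nonzero combination of these rows of `X * A`
  -- vanishes on `J₀`. As `X` is lower triangular, it involves only rows of `A` up to `h`, so it
  -- vanishes on all columns up to `i`, against `hc`.
  let C := Finset.univ.filter fun a => a ≤ h ∧ c a ≤ i
  let g : (C → ℂ) →ₗ[ℂ] (J₀ → ℂ) :=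
    Matrix.vecMulLinear ((X * A).submatrix (Subtype.val : C → Fin k) (Subtype.val : J₀ → Fin n))
  have hg : LinearMap.ker g ≠ ⊥ := LinearMap.ker_ne_bot_of_finrank_lt (by
    rw [Module.finrank_fintype_fun_eq_card, Module.finrank_fintype_fun_eq_card,
      Fintype.card_coe, Fintype.card_coe]
    exact hlt)
  obtain ⟨z, hz, hz0⟩ := Submodule.exists_mem_ne_zero_of_ne_bot hg
  let y : Fin k → ℂ := fun a => if ha : a ∈ C then z ⟨a, ha⟩ else 0
  have hyC : ∀ a, y a ≠ 0 → a ≤ h ∧ c a ≤ i := fun a ha => by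
    by_contra hcon
    exact ha (dif_neg (by simpa [C] using hcon))
  have hyz : ∀ j, Matrix.vecMul y (X * A) j = ∑ a : C, z a * (X * A) a.1 j := by
    intro j
    simp only [Matrix.vecMul, dotProduct]
    rw [← Finset.sum_subset (Finset.subset_univ C), ← Finset.sum_coe_sort]
    · exact Finset.sum_congr rfl fun a _ => by simp [y]
    · intro a _ ha
      rw [show y a = 0 from dif_neg ha, zero_mul]
  have hy0 : y = 0 := by
    refine hc i y (fun a ha => (hyC a ha).2) fun j hj => ?_
    rw [← Matrix.vecMul_vecMul]
    refine hker _ (fun a ha => ?_) (fun j hj => ?_) j hj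
    · simp only [Matrix.vecMul, dotProduct]
      refine Finset.sum_eq_zero fun s _ => ?_
      by_cases hs : y s = 0
      · rw [hs, zero_mul]
      · rw [hX.2 _ _ ((hyC s hs).1.trans_lt ha), mul_zero]
    · rw [Matrix.vecMul_vecMul, hyz]
      exact congrFun (LinearMap.mem_ker.mp hz) ⟨j, hj⟩
  refine hz0 (funext fun a => ?_)
  have := congrFun hy0 a.1
  simpa [y] using this

/-- A multihomogeneous polynomial that vanishes on the cell of `v` vanishes at every matrix with
independent rows where the flag minors that vanish on the cell do. -/
theorem FubiniWord.eval_eq_zero_of_flagMinor {v : FubiniWord n k} {A : Matrix (Fin k) (Fin n) ℂ}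
    (hA : ∀ x, Matrix.vecMul x A = 0 → x = 0) (hT : ∀ J ∈ v.truly, flagMinor J A = 0)
    {f : MvPolynomial (Fin k × Fin n) ℂ} (hf : IsMultihomogeneous f)
    (h : ∀ M ∈ v.cellMatrices, MvPolynomial.eval (fun p => M p.1 p.2) f = 0) :
    MvPolynomial.eval (fun p => A p.1 p.2) f = 0 := by
  obtain ⟨X, hX, c, hsupp, hc⟩ :=
    exists_lowerUnitriangular_mul_staircase hA fun j => v.alpha (v.letter j)
  obtain ⟨Z, hZ, hZX⟩ := exists_inverse_mem_lowerUnitriangular hX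
  have := VanishesOnStaircase.of_countLE (toLex v.alpha) (v.vanishesOnStaircase_alpha hf h)
    (v.countLE_le_of_flagMinor hA hT hX hc) Z hZ (X * A) hsupp
  rwa [← Matrix.mul_assoc, hZX, Matrix.one_mul] at this

/-- A flag minor that does not vanish at `M_w` vanishes nowhere on the cell of `w`. -/
theorem FubiniWord.flagMinor_ne_zero_of_matrix {w : FubiniWord n k} {J : FlagIndex n k}
    (hJ : flagMinor J w.matrix ≠ 0) {M : Matrix (Fin k) (Fin n) ℂ} (hM : M ∈ w.cellMatrices) :
    flagMinor J M ≠ 0 := by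
  obtain ⟨X, hX, Y, hY, rfl⟩ := hM
  rw [flagMinor_mul hX]
  obtain ⟨σ, hσ⟩ := exists_perm_of_det_ne_zero hJ
  have hletter : ∀ s, w.letter (J.1.orderEmbOfFin rfl s) = Fin.castLE J.2.2 (σ s) := by
    intro s
    have := hσ s
    simpa [matrix] using this
  -- The permutation `σ` puts the ones at `(w_j, j)` on the diagonal, and the staircase support is
  -- then triangular in the order of `w.alpha`.
  have hdet : ((Y.submatrix (Fin.castLE J.2.2) (J.1.orderEmbOfFin rfl)).submatrix σ id).det = 1 := by
    refine det_eq_one_of_injective (g := fun s => w.alpha (Fin.castLE J.2.2 (σ s)))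
      (w.alpha_injective.comp ((Fin.castLE_injective J.2.2).comp σ.injective))
      (fun s t hst => ?_) (fun s => ?_)
    · rw [← hletter t]
      exact alpha_le_of_patternMatrices hY hst
    · simp only [Matrix.submatrix_apply, id, ← hletter s]
      exact patternMatrices_letter hY _
  rw [Matrix.det_permute] at hdet
  exact right_ne_zero_of_mul (hdet ▸ one_ne_zero)

/-! ### Minors as multihomogeneous polynomials -/

open MvPolynomial

section Minors

theorem isMultihomogeneous_det {h : ℕ} (e : Fin h → Fin k) (g : Fin h → Fin n) :
    IsMultihomogeneous ((Matrix.mvPolynomialX (Fin k) (Fin n) ℂ).submatrix e g).det := by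
  refine ⟨∑ s, Pi.single (g s) 1, ?_⟩
  rw [Matrix.det_apply']
  refine IsWeightedHomogeneous.sum _ _ _ fun σ _ => ?_
  have : ((Equiv.Perm.sign σ : ℤ) : MvPolynomial (Fin k × Fin n) ℂ) =
      C ((Equiv.Perm.sign σ : ℤ) : ℂ) := by simp
  rw [this]
  refine IsWeightedHomogeneous.C_mul (IsWeightedHomogeneous.prod _ _ _ fun s _ => ?_) _
  exact isWeightedHomogeneous_X ℂ _ (e (σ s), g s)

theorem eval_det {h : ℕ} (e : Fin h → Fin k) (g : Fin h → Fin n) (A : Matrix (Fin k) (Fin n) ℂ) :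
    eval (fun p => A p.1 p.2) ((Matrix.mvPolynomialX (Fin k) (Fin n) ℂ).submatrix e g).det =
      (A.submatrix e g).det := by
  rw [RingHom.map_det]
  congr 1
  ext i j
  simp [Matrix.mvPolynomialX]

/-- The flag minor on the columns `J` as the minor on the first `|J|` rows. -/
def FlagIndex.toMinorIndex (J : FlagIndex n k) : MinorIndex n k :=
  ⟨(Finset.univ.map (Fin.castLEEmb J.2.2), J.1), by simp, J.2.1⟩

theorem minor_toMinorIndex {R : Type} [CommRing R] (J : FlagIndex n k)
    (A : Matrix (Fin k) (Fin n) R) : minor J.toMinorIndex A = flagMinor J A := by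
  have h : Fin.castLE J.2.2 = (J.toMinorIndex.1.1.orderEmbOfFin J.toMinorIndex.2.1) :=
    Finset.orderEmbOfFin_unique _
      (fun x => Finset.mem_map.mpr ⟨x, Finset.mem_univ x, rfl⟩) (Fin.strictMono_castLE J.2.2)
  rw [minor, ← h]
  rfl

end Minors

/-! ### Representing matrices and the Zariski topology -/

namespace SpanningLineConfig

variable {l : SpanningLineConfig n k} {A B : Matrix (Fin k) (Fin n) ℂ}

theorem exists_isRepresentedBy (l : SpanningLineConfig n k) : ∃ A, l.IsRepresentedBy A :=
  ⟨Matrix.of fun i j => (l.1 j).rep i, fun _ => Projectivization.submodule_eq _⟩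

theorem IsRepresentedBy.exists_smul (hA : l.IsRepresentedBy A) (hB : l.IsRepresentedBy B) :
    ∃ c : Fin n → ℂ, ∀ i j, A i j = c j * B i j := by
  have : ∀ j, ∃ c : ℂ, ∀ i, A i j = c * B i j := by
    intro j
    have h : (fun i => A i j) ∈ Submodule.span ℂ {fun i => B i j} := by
      rw [← hB j, hA j]
      exact Submodule.mem_span_singleton_self _
    obtain ⟨c, hc⟩ := Submodule.mem_span_singleton.mp h
    exact ⟨c, fun i => (congrFun hc i).symm⟩
  choose c hc using this
  exact ⟨c, fun i j => hc j i⟩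

theorem IsRepresentedBy.eval_ne_zero {f : MvPolynomial (Fin k × Fin n) ℂ}
    (hf : IsMultihomogeneous f) (hA : l.IsRepresentedBy A) (hB : l.IsRepresentedBy B)
    (h : eval (fun p => A p.1 p.2) f ≠ 0) : eval (fun p => B p.1 p.2) f ≠ 0 := by
  obtain ⟨d, hd⟩ := hf
  obtain ⟨c, hc⟩ := hA.exists_smul hB
  have h1 := eval_mul_column hd B c
  rw [show (fun p : Fin k × Fin n => c p.2 * B p.1 p.2) = fun p => A p.1 p.2 from
    funext fun p => (hc p.1 p.2).symm] at h1
  rw [h1] at h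
  exact right_ne_zero_of_mul h

theorem IsRepresentedBy.eq_zero_of_vecMul (hA : l.IsRepresentedBy A) (x : Fin k → ℂ)
    (hx : Matrix.vecMul x A = 0) : x = 0 := by
  have h : ∀ y : Fin k → ℂ, dotProduct x y = 0 := by
    intro y
    have hle : (⨆ j, (l.1 j).submodule) ≤ LinearMap.ker (dotProductBilin ℂ ℂ x) := by
      refine iSup_le fun j => ?_
      rw [hA j, Submodule.span_singleton_le_iff_mem]
      exact congrFun hx j
    rw [l.2] at hle
    exact hle (Submodule.mem_top (x := y))
  funext a
  simpa using h (Pi.single a 1)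

end SpanningLineConfig

open SpanningLineConfig

theorem isTopologicalBasis_nonvanishingLocus :
    TopologicalSpace.IsTopologicalBasis
      {s : Set (SpanningLineConfig n k) | ∃ f : MvPolynomial (Fin k × Fin n) ℂ,
        IsMultihomogeneous f ∧ s = nonvanishingLocus f} := by
  refine ⟨?_, ?_, rfl⟩
  · rintro _ ⟨f, hf, rfl⟩ _ ⟨g, hg, rfl⟩ l ⟨⟨A, hA, hfA⟩, ⟨B, hB, hgB⟩⟩
    refine ⟨_, ⟨f * g, ?_, rfl⟩, ⟨A, hA, ?_⟩, ?_⟩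
    · obtain ⟨d, hd⟩ := hf
      obtain ⟨e, he⟩ := hg
      exact ⟨d + e, hd.mul he⟩
    · rw [map_mul]
      exact mul_ne_zero hfA (hB.eval_ne_zero hg hA hgB)
    · rintro l' ⟨M, hM, hfg⟩
      rw [map_mul] at hfg
      exact ⟨⟨M, hM, left_ne_zero_of_mul hfg⟩, ⟨M, hM, right_ne_zero_of_mul hfg⟩⟩
  · refine Set.eq_univ_of_forall fun l => ?_
    obtain ⟨A, hA⟩ := l.exists_isRepresentedBy
    exact ⟨_, ⟨1, ⟨0, isWeightedHomogeneous_one ℂ _⟩, rfl⟩, A, hA, by simp⟩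

/-! ### Cells, closures and the criteria -/

namespace FubiniWord

variable {v w : FubiniWord n k}

/-- The columns at initial positions have determinant `1`, hence span; no column vanishes, because
`Y` has a one in each and `X` is invertible. -/
theorem exists_mem_cell {A : Matrix (Fin k) (Fin n) ℂ} (hA : A ∈ w.cellMatrices) :
    ∃ l ∈ w.cell, l.IsRepresentedBy A := by
  obtain ⟨X, hX, Y, hY, rfl⟩ := id hA
  have hdet : ((X * Y).submatrix id w.alpha).det = 1 := by
    have h : (X * Y).submatrix id w.alpha = X * Y.submatrix id w.alpha := rfl
    rw [h, Matrix.det_mul, det_of_mem_lowerUnitriangular hX, one_mul]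
    refine det_eq_one_of_injective w.alpha_injective (fun a b hab => ?_) fun a => ?_
    · simpa [w.letter_alpha] using alpha_le_of_patternMatrices hY hab
    · simpa [w.letter_alpha] using patternMatrices_letter hY (w.alpha a)
  have hne : ∀ j, (fun i => (X * Y) i j) ≠ 0 := by
    intro j h
    obtain ⟨Z, -, hZ⟩ := exists_inverse_mem_lowerUnitriangular hX
    have h1 : Matrix.mulVec (Z * X) (fun i => Y i j) = 0 := by
      rw [← Matrix.mulVec_mulVec]
      have : Matrix.mulVec X (fun i => Y i j) = 0 := h
      rw [this, Matrix.mulVec_zero]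
    rw [hZ, Matrix.one_mulVec] at h1
    have h2 := patternMatrices_letter hY j
    rw [show Y (w.letter j) j = 0 from congrFun h1 _] at h2
    exact zero_ne_one h2
  have hspan : ⨆ j, (Projectivization.mk ℂ _ (hne j)).submodule = ⊤ := by
    have hu : IsUnit ((X * Y).submatrix id w.alpha) := by
      rw [Matrix.isUnit_iff_isUnit_det, hdet]; exact isUnit_one
    have hli := Matrix.linearIndependent_cols_iff_isUnit.mpr hu
    rw [eq_top_iff, ← hli.span_eq_top_of_card_eq_finrank' (by simp), Submodule.span_le]
    rintro _ ⟨a, rfl⟩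
    refine Submodule.mem_iSup_of_mem (w.alpha a) ?_
    rw [Projectivization.submodule_mk]
    exact Submodule.mem_span_singleton_self _
  exact ⟨⟨_, hspan⟩, ⟨_, hA, fun j => Projectivization.submodule_mk _ _⟩,
    fun j => Projectivization.submodule_mk _ _⟩

theorem eval_eq_zero_of_mem_variety {l : SpanningLineConfig n k} (hl : l ∈ v.variety)
    {A : Matrix (Fin k) (Fin n) ℂ} (hA : l.IsRepresentedBy A)
    {f : MvPolynomial (Fin k × Fin n) ℂ} (hf : IsMultihomogeneous f)
    (h : ∀ M ∈ v.cellMatrices, eval (fun p => M p.1 p.2) f = 0) :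
    eval (fun p => A p.1 p.2) f = 0 := by
  by_contra hne
  obtain ⟨l', ⟨B, hB, hfB⟩, M, hM, hM'⟩ := isTopologicalBasis_nonvanishingLocus.mem_closure_iff.mp
    hl _ ⟨f, hf, rfl⟩ ⟨A, hA, hne⟩
  exact hB.eval_ne_zero hf hM' hfB (h M hM)

theorem mem_variety_iff {l : SpanningLineConfig n k} {A : Matrix (Fin k) (Fin n) ℂ}
    (hA : l.IsRepresentedBy A) : l ∈ v.variety ↔ ∀ J ∈ v.truly, flagMinor J A = 0 := by
  constructor
  · intro hl J hJ
    rw [flagMinor, ← eval_det]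
    refine eval_eq_zero_of_mem_variety hl hA (isMultihomogeneous_det _ _) fun M hM => ?_
    rw [eval_det]
    exact hJ M hM
  · intro hT
    refine isTopologicalBasis_nonvanishingLocus.mem_closure_iff.mpr ?_
    rintro _ ⟨f, hf, rfl⟩ ⟨B, hB, hfB⟩
    by_contra hempty
    refine hB.eval_ne_zero hf hA hfB
      (v.eval_eq_zero_of_flagMinor hA.eq_zero_of_vecMul hT hf fun M hM => ?_)
    by_contra hne
    obtain ⟨l', hl', hM'⟩ := exists_mem_cell hM
    exact hempty ⟨l', ⟨M, hM', hne⟩, hl'⟩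

theorem mediumRoastLE_iff : MediumRoastLE v w ↔ v.truly ⊆ w.truly := by
  constructor
  · intro h J hJ M hM
    obtain ⟨l, hl, hM'⟩ := exists_mem_cell hM
    exact (mem_variety_iff hM').mp (h hl) J hJ
  · rintro h l ⟨A, hA, hl⟩
    exact (mem_variety_iff hl).mpr fun J hJ => h hJ A hA

theorem vanishingMinors_subset_iff : v.vanishingMinors ⊆ w.vanishingMinors ↔ v.truly ⊆ w.truly := by
  constructor
  · intro h J hJ M hM
    rw [← minor_toMinorIndex]
    refine h (fun N hN => ?_) M hM
    rw [minor_toMinorIndex]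
    exact hJ N hN
  · intro h p hp M hM
    obtain ⟨l, hl, hM'⟩ := exists_mem_cell hM
    rw [minor, ← eval_det]
    -- Arbitrary minors are multihomogeneous too, so they pass to the closure of `C_v`, which
    -- contains `C_w` by the flag minor criterion.
    refine eval_eq_zero_of_mem_variety (mediumRoastLE_iff.mpr h hl) hM'
      (isMultihomogeneous_det _ _) fun N hN => ?_
    rw [eval_det]
    exact hp N hN

theorem minorIdeal_le_iff : v.minorIdeal ≤ w.minorIdeal ↔ v.truly ⊆ w.truly := by
  rw [← vanishingMinors_subset_iff]
  refine ⟨fun h p hp M hM => ?_, fun h => Ideal.span_mono (Set.image_mono h)⟩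
  -- Evaluation at a point of the cell kills all generators, so every minor in the ideal vanishes on
  -- the cell.
  have hle : w.minorIdeal ≤ RingHom.ker (eval fun p : Fin k × Fin n => M p.1 p.2) := by
    refine Ideal.span_le.mpr ?_
    rintro _ ⟨q, hq, rfl⟩
    exact (eval_det _ _ M).trans (hq M hM)
  rw [minor, ← eval_det]
  exact hle (h (Ideal.subset_span ⟨p, hp, rfl⟩))

theorem touches_iff : Touches v w ↔ v.truly ⊆ w.sometimes ∪ w.truly := by
  constructor
  · rintro ⟨l, hl, A, hA, hl'⟩ J hJ
    have h0 := (mem_variety_iff hl').mp hl J hJ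
    by_cases h : ∃ B ∈ w.cellMatrices, flagMinor J B ≠ 0
    · obtain ⟨B, hB, hne⟩ := h
      exact Or.inl ⟨A, hA, B, hB, h0, hne⟩
    · exact Or.inr fun M hM => not_not.mp fun hne => h ⟨M, hM, hne⟩
  · intro h
    obtain ⟨l, hl, hM⟩ := exists_mem_cell w.matrix_mem_cellMatrices
    refine ⟨l, (mem_variety_iff hM).mpr fun J hJ => ?_, hl⟩
    rcases h hJ with ⟨A, hA, -, -, h0, -⟩ | h0
    · by_contra hne
      exact flagMinor_ne_zero_of_matrix hne hA h0
    · exact h0 _ matrix_mem_cellMatrices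

end FubiniWord

end FubiniBruhat

/-- The first block gives the criterion for the medium roast order, for each of its three
usual descriptions; the second gives the criterion for the touching relation. -/
theorem mainTheorem3 {n k : ℕ} (v w : FubiniBruhat.FubiniWord n k) :
    ((FubiniBruhat.MediumRoastLE v w ↔ v.truly ⊆ w.truly) ∧
      (v.minorIdeal ≤ w.minorIdeal ↔ v.truly ⊆ w.truly) ∧
      (v.vanishingMinors ⊆ w.vanishingMinors ↔ v.truly ⊆ w.truly)) ∧
    (FubiniBruhat.Touches v w ↔ v.truly ⊆ w.sometimes ∪ w.truly) :=
  ⟨⟨FubiniBruhat.FubiniWord.mediumRoastLE_iff, FubiniBruhat.FubiniWord.minorIdeal_le_iff,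
    FubiniBruhat.FubiniWord.vanishingMinors_subset_iff⟩, FubiniBruhat.FubiniWord.touches_iff⟩
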